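/- Let $N\ge 1$, $1\le p<\infty$, and let $K\subset\mathbf R^N$ be compact. For an open set $\Omega\subset\mathbf R^N$ let $W^{1,p}(\Omega,\mathbf R^N)$ be the set of functions $u:\mathbf R^N\to\mathbf R$ whose restriction to $\Omega$ belongs to $W^{1,p}(\Omega)$, i.e. $u$ and all its first order weak partial derivatives on $\Omega$ are in $L^p(\Omega)$. For compact $F\subset\mathbf R^N$ put $$C_{1,p}(F)=\inf\Big\{\sum_{|\alpha|\le 1}\|D^\alpha\varphi\|_{L^p(\mathbf R^N)}:\ \varphi\in C_0^\infty(\mathbf R^N),\ \varphi\ge 1\text{ on }F\Big\},$$ and for open $\omega\subset\mathbf R^N$ put $C_{1,p}(\omega)=\sup\{C_{1,p}(F): F\subset\omega\text{ compact}\}$. Let $Q$ be the set of measurable functions $u:\mathbf R^N\to\mathbf R$ that are quasicontinuous: for every $\varepsilon>0$ there is an open set $\omega$ with $C_{1,p}(\omega)<\varepsilon$ such that the restriction of $u$ to $\mathbf R^N\setminus\omega$ is continuous. Say that $K$ has the $J_p$-property if $$Q\cap W^{1,p}(\mathbf R^N\setminus K,\mathbf R^N)=Q\cap W^{1,p}(\mathbf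 R^N),$$ and the $J_p(\mathrm{cont})$-property if the same holds with $Q$ replaced by $C(\mathbf R^N)$. **Corollary 1.9.** Suppose that there are $N$ linearly independent directions $v_1,\dots,v_N\in\mathbf R^N$ such that, for each $i$, almost every line parallel to $v_i$ meets $K$ in an at most countable set; that is, the set of those $y$ in the hyperplane $v_i^\perp$ for which $K\cap(y+\mathbf R v_i)$ is uncountable has $(N-1)$-dimensional Lebesgue measure zero. Then $K$ has the $J_p$-property, and also the $J_p(\mathrm{cont})$-property. -/

import Mathlib

open MeasureTheory
open scoped ENNReal

noncomputable section

namespace SobolevRemovability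

variable {N : ℕ}

/-- The classical `i`-th partial derivative of a (differentiable) function on `ℝ^N`. -/
def partialDeriv (i : Fin N) (φ : EuclideanSpace ℝ (Fin N) → ℝ)
    (x : EuclideanSpace ℝ (Fin N)) : ℝ :=
  fderiv ℝ φ x (EuclideanSpace.single i 1)

/-- `φ` belongs to `C₀^∞(Ω)`: it is smooth, with compact support contained in `Ω`. -/
def IsTestFunction (Ω : Set (EuclideanSpace ℝ (Fin N)))
    (φ : EuclideanSpace ℝ (Fin N) → ℝ) : Prop :=
  ContDiff ℝ (⊤ : ℕ∞) φ ∧ HasCompactSupport φ ∧ tsupport φ ⊆ Ω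

/-- `g` is the `i`-th weak partial derivative of `u` on `Ω`
(used below only for `u` and `g` in `L^p(Ω)` with `p ≥ 1`, so that the integrals converge). -/
def IsWeakPartialDeriv (Ω : Set (EuclideanSpace ℝ (Fin N))) (i : Fin N)
    (u g : EuclideanSpace ℝ (Fin N) → ℝ) : Prop :=
  ∀ φ : EuclideanSpace ℝ (Fin N) → ℝ, IsTestFunction Ω φ →
    ∫ x in Ω, u x * partialDeriv i φ x = -∫ x in Ω, g x * φ x

/-- The set of functions `u : ℝ^N → ℝ` whose restriction to the open set `Ω` belongs to
`W^{1,p}(Ω)`: `u` and all its first order weak derivatives on `Ω` are in `L^p(Ω)`. -/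
def W1p (p : ℝ≥0∞) (Ω : Set (EuclideanSpace ℝ (Fin N))) :
    Set (EuclideanSpace ℝ (Fin N) → ℝ) :=
  {u | MemLp u p (volume.restrict Ω) ∧
    ∀ i : Fin N, ∃ g : EuclideanSpace ℝ (Fin N) → ℝ,
      MemLp g p (volume.restrict Ω) ∧ IsWeakPartialDeriv Ω i u g}

/-- The first order Sobolev norm `∑_{|α| ≤ 1} ‖D^α φ‖_{L^p(ℝ^N)}` of a smooth function. -/
def sobolevNorm (p : ℝ≥0∞) (φ : EuclideanSpace ℝ (Fin N) → ℝ) : ℝ≥0∞ :=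
  eLpNorm φ p volume + ∑ i : Fin N, eLpNorm (partialDeriv i φ) p volume

/-- The capacity `C_{1,p}` of a compact set. -/
def capCompact (p : ℝ≥0∞) (K : Set (EuclideanSpace ℝ (Fin N))) : ℝ≥0∞ :=
  sInf {c | ∃ φ : EuclideanSpace ℝ (Fin N) → ℝ,
    IsTestFunction Set.univ φ ∧ (∀ x ∈ K, 1 ≤ φ x) ∧ c = sobolevNorm p φ}

/-- The capacity `C_{1,p}` of an open set. -/
def capOpen (p : ℝ≥0∞) (ω : Set (EuclideanSpace ℝ (Fin N))) : ℝ≥0∞ :=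
  sSup {c | ∃ K : Set (EuclideanSpace ℝ (Fin N)), IsCompact K ∧ K ⊆ ω ∧ c = capCompact p K}

/-- The set `Q` of (Lebesgue) measurable functions on `ℝ^N` that are quasicontinuous with
respect to `C_{1,p}`: off open sets of arbitrarily small capacity, the restriction of the function
is continuous. -/
def quasiContinuous (p : ℝ≥0∞) : Set (EuclideanSpace ℝ (Fin N) → ℝ) :=
  {u | AEMeasurable u volume ∧
    ∀ ε : ℝ≥0∞, 0 < ε → ∃ ω : Set (EuclideanSpace ℝ (Fin N)),
      IsOpen ω ∧ capOpen p ω < ε ∧ ContinuousOn u ωᶜ}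

/-- The (quasicontinuous) `J_p`-property:
every quasicontinuous function that is in `W^{1,p}` off `K` is in `W^{1,p}(ℝ^N)`. -/
def JProperty (p : ℝ≥0∞) (K : Set (EuclideanSpace ℝ (Fin N))) : Prop :=
  quasiContinuous p ∩ W1p p Kᶜ = quasiContinuous p ∩ W1p p Set.univ

/-- The continuous `J_p`-property, `J_p(cont)`. -/
def JPropertyCont (p : ℝ≥0∞) (K : Set (EuclideanSpace ℝ (Fin N))) : Prop :=
  {u | Continuous u} ∩ W1p p Kᶜ = {u | Continuous u} ∩ W1p p Set.univ

/-- The line through `y` in the direction `v`. -/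
def line (y v : EuclideanSpace ℝ (Fin N)) : Set (EuclideanSpace ℝ (Fin N)) :=
  {x | ∃ t : ℝ, x = y + t • v}

/-- Almost every line in the direction `v` meets `K` in an at most countable set. The lines in the
direction `v ≠ 0` are parametrized by their intersection with the hyperplane orthogonal to `v`,
which carries its `(N-1)`-dimensional Lebesgue measure. -/
def AELineMeetsCountably (K : Set (EuclideanSpace ℝ (Fin N)))
    (v : EuclideanSpace ℝ (Fin N)) : Prop :=
  ∀ᵐ y : (Submodule.span ℝ {v})ᗮ ∂volume,
    (K ∩ line (y : EuclideanSpace ℝ (Fin N)) v).Countable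

end SobolevRemovability

end

/-!
On almost every line parallel to `v i`, a function `u` that is continuous along the line and has a
weak directional derivative off `K` differs from a primitive of that derivative by a continuous
function which is locally constant off a countable closed set. Such a function is constant by the
mean value theorem with countably many exceptional points, so `u` is absolutely continuous along the
line, and integrating by parts line by line shows that the weak derivative in the direction `v i`
persists across `K`. Since the directional derivative is linear in the direction, `N` independent
directions give the whole gradient.

Quasicontinuous functions are continuous on almost every line because the measure of the projection
of a bounded part of a set along a line direction is bounded by a constant times its capacity: on
each line meeting `{φ ≥ 1}` the integral of `|φ| + |φ'|` over a unit segment is at least `1`.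
-/

open Filter Topology Metric
open scoped Convolution

namespace SobolevRemovability

section RealLine

theorem integral_mul_deriv_eq_neg_of_eq_add_integral {f g ψ : ℝ → ℝ} (hg : LocallyIntegrable g)
    (hf : ∀ t, f t = f 0 + ∫ s in (0 : ℝ)..t, g s) (hψ : ContDiff ℝ 1 ψ)
    (hψs : HasCompactSupport ψ) :
    ∫ t, f t * deriv ψ t = -∫ t, g t * ψ t := by
  obtain ⟨R, hR0, hR⟩ : ∃ R : ℝ, 0 < R ∧ tsupport ψ ⊆ Set.Ioo (-R) R := by
    obtain ⟨R, hR0, hR⟩ := hψs.isCompact.isBounded.subset_ball_lt 0 0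
    exact ⟨R, hR0, by rwa [Real.ball_zero_eq_Ioo] at hR⟩
  have hRR : -R ≤ R := by linarith
  have vanish : ∀ t ∉ Set.Ioo (-R) R, ψ t = 0 := fun t ht =>
    image_eq_zero_of_notMem_tsupport fun h => ht (hR h)
  have deriv_vanish : ∀ t ∉ Set.Ioo (-R) R, deriv ψ t = 0 := fun t ht =>
    image_eq_zero_of_notMem_tsupport fun h => ht (hR (tsupport_deriv_subset h))
  have restrict_interval : ∀ h : ℝ → ℝ, (∀ t ∉ Set.Ioo (-R) R, h t = 0) →
      ∫ t in (-R)..R, h t = ∫ t, h t := fun h hh => by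
    rw [intervalIntegral.integral_of_le hRR, setIntegral_eq_integral_of_forall_compl_eq_zero]
    exact fun t ht => hh t fun h' => ht (Set.Ioo_subset_Ioc_self h')
  have f_ac : AbsolutelyContinuousOnInterval f (-R) R := by
    have : IntervalIntegrable g volume (-R) R :=
      (hg.integrableOn_isCompact isCompact_uIcc).intervalIntegrable
    rw [funext hf]
    exact (contDiff_const (n := 1)).contDiffOn.absolutelyContinuousOnInterval.add
      (this.absolutelyContinuousOnInterval_intervalIntegral
        (by rw [Set.uIcc_of_le hRR]; constructor <;> linarith))
  have deriv_f : ∀ᵐ t, deriv f t = g t := by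
    filter_upwards [LocallyIntegrable.ae_hasDerivAt_integral hg] with t ht
    rw [funext hf, ((ht 0).const_add (f 0)).deriv]
  calc ∫ t, f t * deriv ψ t = ∫ t in (-R)..R, f t * deriv ψ t :=
        (restrict_interval _ fun t ht => by rw [deriv_vanish t ht, mul_zero]).symm
    _ = f R * ψ R - f (-R) * ψ (-R) - ∫ t in (-R)..R, deriv f t * ψ t :=
        f_ac.integral_mul_deriv_eq_deriv_mul hψ.contDiffOn.absolutelyContinuousOnInterval
    _ = -∫ t in (-R)..R, g t * ψ t := by
        rw [vanish R (by simp), vanish (-R) (by simp), intervalIntegral.integral_congr_ae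
          (deriv_f.mono fun t ht _ => by rw [ht])]
        ring
    _ = -∫ t, g t * ψ t := by
        rw [restrict_interval _ fun t ht => by rw [vanish t ht, mul_zero]]

theorem eq_of_eventually_eq_off_countable {F : ℝ → ℝ} (hF : Continuous F) {E : Set ℝ}
    (hE : E.Countable) (h : ∀ t ∉ E, ∀ᶠ s in 𝓝 t, F s = F t) (a b : ℝ) : F b = F a := by
  have := integral_eq_of_hasDerivAt_off_countable F (fun _ => 0) hE hF.continuousOn
    (a := a) (b := b) (fun t ht => (hasDerivAt_const t (F t)).congr_of_eventuallyEq (h t ht.2))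
    (by simp)
  rw [intervalIntegral.integral_zero] at this
  linarith

/-- A sequence of smooth bump functions on `ℝ` whose supports shrink to the origin; normalized,
it is a sequence of mollifiers. -/
noncomputable def mollifier (n : ℕ) : ContDiffBump (0 : ℝ) where
  rIn := 1 / (n + 1) / 2
  rOut := 1 / (n + 1)
  rIn_pos := by positivity
  rIn_lt_rOut := half_lt_self (by positivity)

/-- The normalized bump `mollifier n` translated to `x`. For rational `x` these functions form a
countable family of test functions that detects weak derivatives on the line. -/
noncomputable def mollifierAt (n : ℕ) (x t : ℝ) : ℝ :=
  (mollifier n).normed volume (x - t)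

theorem contDiff_mollifierAt (n : ℕ) (x : ℝ) {k : ℕ∞} : ContDiff ℝ k (mollifierAt n x) :=
  (mollifier n).contDiff_normed.comp (contDiff_const.sub contDiff_id)

theorem tsupport_mollifierAt_subset (n : ℕ) (x : ℝ) :
    tsupport (mollifierAt n x) ⊆ closedBall x (1 / (n + 1)) := fun t ht => by
  have : x - t ∈ tsupport ((mollifier n).normed volume) :=
    tsupport_comp_subset_preimage _ (f := fun t => x - t) (by fun_prop) ht
  rwa [ContDiffBump.tsupport_normed_eq, mem_closedBall_zero_iff, ← dist_eq_norm,
    dist_comm] at this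

theorem hasCompactSupport_mollifierAt (n : ℕ) (x : ℝ) : HasCompactSupport (mollifierAt n x) :=
  (isCompact_closedBall _ _).of_isClosed_subset (isClosed_tsupport _)
    (tsupport_mollifierAt_subset n x)

theorem hasDerivAt_mollifier_convolution {F : ℝ → ℝ} (hF : LocallyIntegrable F) (n : ℕ) (x : ℝ) :
    HasDerivAt ((mollifier n).normed volume ⋆[ContinuousLinearMap.lsmul ℝ ℝ, volume] F)
      (-∫ t, F t * deriv (mollifierAt n x) t) x := by
  have h := ((mollifier n).hasCompactSupport_normed (μ := volume)).hasDerivAt_convolution_left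
    (ContinuousLinearMap.lsmul ℝ ℝ) (mollifier n).contDiff_normed hF x
  rw [convolution_lsmul_swap] at h
  rw [← integral_neg]
  refine h.congr_deriv (integral_congr_ae (ae_of_all _ fun t => ?_))
  have : deriv (mollifierAt n x) t = -deriv ((mollifier n).normed volume) (x - t) :=
    deriv_comp_const_sub (f := (mollifier n).normed volume) x t
  simp only [this, smul_eq_mul]
  ring

theorem continuous_integral_mul_deriv_mollifierAt {F : ℝ → ℝ} (hF : LocallyIntegrable F) (n : ℕ) :
    Continuous fun x => ∫ t, F t * deriv (mollifierAt n x) t := by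
  have hsmooth : ContDiff ℝ 1 ((mollifier n).normed volume ⋆[ContinuousLinearMap.lsmul ℝ ℝ] F) :=
    (mollifier n).hasCompactSupport_normed.contDiff_convolution_left _
      (mollifier n).contDiff_normed hF
  refine (hsmooth.continuous_deriv le_rfl).neg.congr fun x => ?_
  rw [Pi.neg_apply, (hasDerivAt_mollifier_convolution hF n x).deriv, neg_neg]

/-- The mollifications of `F` have vanishing derivative at rational points, hence are constant
near each point of `Ω`. -/
theorem eventually_eq_of_integral_mul_deriv_mollifierAt_eq_zero {F : ℝ → ℝ} (hF : Continuous F)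
    {Ω : Set ℝ} (hΩ : IsOpen Ω)
    (h : ∀ (n : ℕ) (q : ℚ), closedBall (q : ℝ) (1 / (n + 1)) ⊆ Ω →
      ∫ t, F t * deriv (mollifierAt n q) t = 0) {t : ℝ} (ht : t ∈ Ω) :
    ∀ᶠ s in 𝓝 t, F s = F t := by
  obtain ⟨δ, hδ, hball⟩ := isOpen_iff.1 hΩ t ht
  have mollification_const : ∀ᶠ n : ℕ in atTop, ∀ s ∈ ball t (δ / 2),
      ((mollifier n).normed volume ⋆[ContinuousLinearMap.lsmul ℝ ℝ] F) s =
        ((mollifier n).normed volume ⋆[ContinuousLinearMap.lsmul ℝ ℝ] F) t := by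
    filter_upwards [tendsto_one_div_add_atTop_nhds_zero_nat.eventually (gt_mem_nhds (half_pos hδ))]
      with n hn
    have rational_zero : ball t (δ / 2) ∩ Set.range ((↑) : ℚ → ℝ) ⊆
        {x | ∫ t, F t * deriv (mollifierAt n x) t = 0} := by
      rintro _ ⟨hq, q, rfl⟩
      refine h n q ((closedBall_subset_ball' ?_).trans hball)
      linarith [mem_ball.1 hq]
    have zero : ball t (δ / 2) ⊆ {x | ∫ t, F t * deriv (mollifierAt n x) t = 0} :=
      (Rat.denseRange_cast.open_subset_closure_inter isOpen_ball).trans <|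
        closure_minimal rational_zero <| isClosed_eq
          (continuous_integral_mul_deriv_mollifierAt hF.locallyIntegrable n) continuous_const
    have hderiv := hasDerivAt_mollifier_convolution hF.locallyIntegrable n
    exact fun s hs => isOpen_ball.is_const_of_deriv_eq_zero
      (convex_ball t (δ / 2)).isPreconnected
      (fun x _ => (hderiv x).differentiableAt.differentiableWithinAt)
      (fun x hx => by rw [(hderiv x).deriv, zero hx]; exact neg_zero) hs
      (mem_ball_self (half_pos hδ))
  have mollification_tendsto := ContDiffBump.convolution_tendsto_right_of_continuous
    (μ := volume) (φ := mollifier) tendsto_one_div_add_atTop_nhds_zero_nat hF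
  filter_upwards [ball_mem_nhds t (half_pos hδ)] with s hs
  refine tendsto_nhds_unique (mollification_tendsto s) ((mollification_tendsto t).congr' ?_)
  filter_upwards [mollification_const] with n hn using (hn s hs).symm

theorem eq_add_integral_of_mollifierAt_tests {u g : ℝ → ℝ} (hu : Continuous u)
    (hg : LocallyIntegrable g) {E : Set ℝ} (hE : IsClosed E) (hEc : E.Countable)
    (h : ∀ (n : ℕ) (q : ℚ), closedBall (q : ℝ) (1 / (n + 1)) ⊆ Eᶜ →
      ∫ t, u t * deriv (mollifierAt n q) t = -∫ t, g t * mollifierAt n q t) (t : ℝ) :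
    u t = u 0 + ∫ s in (0 : ℝ)..t, g s := by
  set H : ℝ → ℝ := fun t => ∫ s in (0 : ℝ)..t, g s
  have hH0 : H 0 = 0 := intervalIntegral.integral_same
  have hHc : Continuous H := intervalIntegral.continuous_primitive
    (fun a b => (hg.integrableOn_isCompact isCompact_uIcc).intervalIntegrable) 0
  have difference_test : ∀ (n : ℕ) (q : ℚ), closedBall (q : ℝ) (1 / (n + 1)) ⊆ Eᶜ →
      ∫ t, (u t - H t) * deriv (mollifierAt n q) t = 0 := by
    intro n q hq
    have hψs := hasCompactSupport_mollifierAt n q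
    have hψ : ContDiff ℝ 1 (mollifierAt n q) := contDiff_mollifierAt n q
    have integrable : ∀ {f : ℝ → ℝ}, Continuous f →
        Integrable fun t => f t * deriv (mollifierAt n q) t := fun hf =>
      (hf.mul (hψ.continuous_deriv le_rfl)).integrable_of_hasCompactSupport hψs.deriv.mul_left
    simp only [sub_mul]
    rw [integral_sub (integrable hu) (integrable hHc), h n q hq,
      integral_mul_deriv_eq_neg_of_eq_add_integral hg (fun t => by rw [hH0, zero_add]) hψ hψs,
      sub_self]
  have : u t - H t = u 0 - H 0 := eq_of_eventually_eq_off_countable (hu.sub hHc) hEc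
    (fun s hs => eventually_eq_of_integral_mul_deriv_mollifierAt_eq_zero (hu.sub hHc)
      hE.isOpen_compl difference_test hs) 0 t
  change u t = u 0 + H t
  linarith

end RealLine

section Slices

theorem ae_locallyIntegrable_slice {Y Z F : Type*} [TopologicalSpace Y] [SigmaCompactSpace Y]
    [MeasurableSpace Y] [TopologicalSpace Z] [SigmaCompactSpace Z] [WeaklyLocallyCompactSpace Z]
    [MeasurableSpace Z] [NormedAddCommGroup F] {μ : Measure Y} [SFinite μ] {ν : Measure Z}
    [SFinite ν] {f : Y × Z → F} (hf : LocallyIntegrable f (μ.prod ν)) :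
    ∀ᵐ y ∂μ, LocallyIntegrable (fun z => f (y, z)) ν := by
  let A := CompactExhaustion.choice Z
  have integrableOn_exhaustion : ∀ n, ∀ᵐ y ∂μ, IntegrableOn (fun z => f (y, z)) (A n) ν := by
    intro n
    rw [← Measure.restrict_univ (μ := μ), ← iUnion_compactCovering, ae_restrict_iUnion_iff]
    intro m
    have := hf.integrableOn_isCompact ((isCompact_compactCovering Y m).prod (A.isCompact n))
    rw [IntegrableOn, ← Measure.prod_restrict] at this
    exact this.prod_right_ae
  filter_upwards [ae_all_iff.2 integrableOn_exhaustion] with y hy z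
  obtain ⟨n, hn⟩ := A.exists_mem_nhds z
  exact ⟨A n, hn, hy n⟩

theorem tsupport_fst_mul_snd_subset {Y Z R : Type*} [TopologicalSpace Y] [TopologicalSpace Z]
    [MulZeroClass R] (η : Y → R) (ψ : Z → R) :
    tsupport (fun z : Y × Z => η z.1 * ψ z.2) ⊆ tsupport η ×ˢ tsupport ψ :=
  closure_minimal (fun _ hz => ⟨subset_tsupport _ (left_ne_zero_of_mul hz),
    subset_tsupport _ (right_ne_zero_of_mul hz)⟩) ((isClosed_tsupport _).prod (isClosed_tsupport _))

theorem hasCompactSupport_fst_mul_snd {Y Z R : Type*} [TopologicalSpace Y] [TopologicalSpace Z]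
    [MulZeroClass R] {η : Y → R} {ψ : Z → R} (hη : HasCompactSupport η)
    (hψ : HasCompactSupport ψ) : HasCompactSupport fun z : Y × Z => η z.1 * ψ z.2 :=
  (hη.isCompact.prod hψ.isCompact).of_isClosed_subset (isClosed_tsupport _)
    (tsupport_fst_mul_snd_subset η ψ)

theorem hasCompactSupport_slice {Y Z R : Type*} [TopologicalSpace Y] [TopologicalSpace Z]
    [R1Space Z] [Zero R] {φ : Y × Z → R} (hφ : HasCompactSupport φ) (y : Y) :
    HasCompactSupport fun z => φ (y, z) :=
  HasCompactSupport.intro (hφ.isCompact.image continuous_snd) fun z hz =>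
    image_eq_zero_of_notMem_tsupport fun h => hz ⟨(y, z), h, rfl⟩

theorem isOpen_setOf_subset_slice {Y Z : Type*} [TopologicalSpace Y] [TopologicalSpace Z]
    {C : Set Z} (hC : IsCompact C) {Ω : Set (Y × Z)} (hΩ : IsOpen Ω) :
    IsOpen {y | C ⊆ {z | (y, z) ∈ Ω}} := by
  refine isOpen_iff_mem_nhds.2 fun y hy => ?_
  obtain ⟨B, I, hB, -, hyB, hCI, hBI⟩ := generalized_tube_lemma
    (isCompact_singleton (x := y)) hC hΩ (by rintro ⟨_, z⟩ ⟨rfl, hz⟩; exact hy hz)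
  exact mem_of_superset (hB.mem_nhds (hyB rfl)) fun y' hy' z hz => hBI ⟨hy', hCI hz⟩

theorem hasDerivAt_slice {Y F : Type*} [NormedAddCommGroup Y] [NormedSpace ℝ Y]
    [NormedAddCommGroup F] [NormedSpace ℝ F] {φ : Y × ℝ → F} (hφ : Differentiable ℝ φ)
    (y : Y) (t : ℝ) : HasDerivAt (fun s => φ (y, s)) (fderiv ℝ φ (y, t) (0, 1)) t :=
  (hφ (y, t)).hasFDerivAt.comp_hasDerivAt t ((hasDerivAt_const t y).prodMk (hasDerivAt_id t))

section Integrals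

variable {Y : Type*} [NormedAddCommGroup Y] [NormedSpace ℝ Y] [FiniteDimensional ℝ Y]
  [MeasurableSpace Y] [BorelSpace Y] {μ : Measure Y} [SFinite μ]

theorem locallyIntegrable_integral_slice_mul {W : Y × ℝ → ℝ}
    (hW : LocallyIntegrable W (μ.prod volume)) {θ : ℝ → ℝ} (hθ : Continuous θ)
    (hθs : HasCompactSupport θ) : LocallyIntegrable (fun y => ∫ t, W (y, t) * θ t) μ := by
  have : ProperSpace Y := FiniteDimensional.proper_real Y
  rw [locallyIntegrable_iff]
  intro C hC
  have integrable_on_support : IntegrableOn (fun z => W z * θ z.2) (C ×ˢ tsupport θ)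
      (μ.prod volume) :=
    (hW.integrableOn_isCompact (hC.prod hθs)).mul_continuousOn
      (hθ.comp continuous_snd).continuousOn (hC.prod hθs)
  have integrable_on_cylinder : IntegrableOn (fun z => W z * θ z.2) (C ×ˢ Set.univ)
      (μ.prod volume) := by
    refine integrable_on_support.of_forall_sdiff_eq_zero
      (hC.measurableSet.prod MeasurableSet.univ) fun z hz => ?_
    rw [image_eq_zero_of_notMem_tsupport fun h => hz.2 ⟨hz.1.1, h⟩, mul_zero]
  rw [IntegrableOn, ← Measure.prod_restrict, Measure.restrict_univ] at integrable_on_cylinder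
  exact integrable_on_cylinder.integral_prod_left

theorem integral_mul_integral_slice_mul {W : Y × ℝ → ℝ}
    (hW : LocallyIntegrable W (μ.prod volume)) {η : Y → ℝ} (hη : Continuous η)
    (hηs : HasCompactSupport η) {θ : ℝ → ℝ} (hθ : Continuous θ) (hθs : HasCompactSupport θ) :
    ∫ y, (η y * ∫ t, W (y, t) * θ t) ∂μ = ∫ z, W z * (η z.1 * θ z.2) ∂μ.prod volume := by
  have : ProperSpace Y := FiniteDimensional.proper_real Y
  have integrable : Integrable (fun z => W z * (η z.1 * θ z.2)) (μ.prod volume) :=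
    hW.integrable_smul_right_of_hasCompactSupport (by fun_prop)
      (hasCompactSupport_fst_mul_snd hηs hθs)
  rw [integral_prod _ integrable]
  simp only [← integral_const_mul, mul_left_comm]

end Integrals

end Slices

section WeakDerivative

/-- `g` is the weak derivative of `u` in the direction `v` on the open set `Ω`, with respect to
the measure `μ`. Test functions on `Ω` are smooth functions on the whole space with compact support
in `Ω`. -/
def IsWeakDerivAlong {E : Type*} [NormedAddCommGroup E] [NormedSpace ℝ E] [MeasurableSpace E]
    (μ : Measure E) (Ω : Set E) (v : E) (u g : E → ℝ) : Prop :=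
  ∀ φ : E → ℝ, ContDiff ℝ (⊤ : ℕ∞) φ → HasCompactSupport φ → tsupport φ ⊆ Ω →
    ∫ x, u x * fderiv ℝ φ x v ∂μ = -∫ x, g x * φ x ∂μ

section Product

variable {Y : Type*} [NormedAddCommGroup Y] [NormedSpace ℝ Y] [FiniteDimensional ℝ Y]
  [MeasurableSpace Y] [BorelSpace Y] {μ : Measure Y} [SFinite μ] {U G : Y × ℝ → ℝ}

theorem IsWeakDerivAlong.ae_slice {Ω : Set (Y × ℝ)}
    (h : IsWeakDerivAlong (μ.prod volume) Ω (0, 1) U G) (hΩ : IsOpen Ω)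
    (hU : LocallyIntegrable U (μ.prod volume)) (hG : LocallyIntegrable G (μ.prod volume))
    {ψ : ℝ → ℝ} (hψ : ContDiff ℝ (⊤ : ℕ∞) ψ) (hψs : HasCompactSupport ψ) :
    ∀ᵐ y ∂μ, tsupport ψ ⊆ {t | (y, t) ∈ Ω} →
      ∫ t, U (y, t) * deriv ψ t = -∫ t, G (y, t) * ψ t := by
  have : ProperSpace Y := FiniteDimensional.proper_real Y
  have hψ' : Continuous (deriv ψ) := hψ.continuous_deriv (by simp)
  have locallyIntegrable_U := locallyIntegrable_integral_slice_mul hU hψ' hψs.deriv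
  have locallyIntegrable_G := locallyIntegrable_integral_slice_mul hG hψ.continuous hψs
  have test : ∀ η : Y → ℝ, ContDiff ℝ (⊤ : ℕ∞) η → HasCompactSupport η →
      tsupport η ⊆ {y | tsupport ψ ⊆ {t | (y, t) ∈ Ω}} →
      ∫ y, η y • ((∫ t, U (y, t) * deriv ψ t) + ∫ t, G (y, t) * ψ t) ∂μ = 0 := by
    intro η hη hηs hηΩ
    have smooth : ContDiff ℝ (⊤ : ℕ∞) fun z : Y × ℝ => η z.1 * ψ z.2 :=
      (hη.comp contDiff_fst).mul (hψ.comp contDiff_snd)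
    have fderiv_eq : ∀ z : Y × ℝ,
        fderiv ℝ (fun z : Y × ℝ => η z.1 * ψ z.2) z (0, 1) = η z.1 * deriv ψ z.2 := fun z =>
      (hasDerivAt_slice (smooth.differentiable (by simp)) z.1 z.2).unique
        ((hψ.differentiable (by simp) z.2).hasDerivAt.const_mul (η z.1))
    have tensor_test := h _ smooth (hasCompactSupport_fst_mul_snd hηs hψs)
      ((tsupport_fst_mul_snd_subset η ψ).trans fun z hz => hηΩ hz.1 hz.2)
    have integrable : ∀ {f : Y → ℝ}, LocallyIntegrable f μ → Integrable (fun y => η y * f y) μ :=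
      fun hf => hf.integrable_smul_left_of_hasCompactSupport hη.continuous hηs
    simp only [smul_eq_mul, mul_add]
    rw [integral_add (integrable locallyIntegrable_U) (integrable locallyIntegrable_G),
      integral_mul_integral_slice_mul hU hη.continuous hηs hψ' hψs.deriv,
      integral_mul_integral_slice_mul hG hη.continuous hηs hψ.continuous hψs]
    simp only [fderiv_eq] at tensor_test
    rw [tensor_test, neg_add_cancel]
  filter_upwards [(isOpen_setOf_subset_slice hψs hΩ).ae_eq_zero_of_integral_contDiff_smul_eq_zero
    ((locallyIntegrable_U.add locallyIntegrable_G).locallyIntegrableOn _) test] with y hy hyΩ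
  exact eq_neg_of_add_eq_zero_left (hy hyΩ)

theorem IsWeakDerivAlong.univ_of_countable_slices {K : Set (Y × ℝ)}
    (h : IsWeakDerivAlong (μ.prod volume) Kᶜ (0, 1) U G) (hK : IsClosed K)
    (hU : LocallyIntegrable U (μ.prod volume)) (hG : LocallyIntegrable G (μ.prod volume))
    (hKc : ∀ᵐ y ∂μ, {t | (y, t) ∈ K}.Countable)
    (hUc : ∀ᵐ y ∂μ, Continuous fun t => U (y, t)) :
    IsWeakDerivAlong (μ.prod volume) Set.univ (0, 1) U G := by
  intro φ hφ hφs _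
  have : ProperSpace Y := FiniteDimensional.proper_real Y
  have integrable_U : Integrable (fun z => U z * fderiv ℝ φ z (0, 1)) (μ.prod volume) :=
    hU.integrable_smul_right_of_hasCompactSupport
      ((hφ.continuous_fderiv (by simp)).clm_apply continuous_const) (hφs.fderiv_apply ℝ _)
  have integrable_G : Integrable (fun z => G z * φ z) (μ.prod volume) :=
    hG.integrable_smul_right_of_hasCompactSupport hφ.continuous hφs
  have ae_mollifierAt_tests : ∀ᵐ y ∂μ, ∀ (n : ℕ) (q : ℚ),
      tsupport (mollifierAt n q) ⊆ {t | (y, t) ∈ Kᶜ} →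
      ∫ t, U (y, t) * deriv (mollifierAt n q) t = -∫ t, G (y, t) * mollifierAt n q t := by
    simp only [ae_all_iff]
    exact fun n q => h.ae_slice hK.isOpen_compl hU hG (contDiff_mollifierAt n q)
      (hasCompactSupport_mollifierAt n q)
  rw [integral_prod _ integrable_U, integral_prod _ integrable_G, ← integral_neg]
  refine integral_congr_ae ?_
  filter_upwards [ae_mollifierAt_tests, hKc, hUc, ae_locallyIntegrable_slice hG]
    with y hy hyK hyU hyG
  have slice_eq := eq_add_integral_of_mollifierAt_tests hyU hyG
    (hK.preimage (Continuous.prodMk_right y)) hyK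
    fun n q hq => hy n q ((tsupport_mollifierAt_subset n q).trans hq)
  have smooth_slice : ContDiff ℝ 1 fun t => φ (y, t) :=
    (hφ.of_le (by simp)).comp (contDiff_prodMk_right y)
  have by_parts := integral_mul_deriv_eq_neg_of_eq_add_integral hyG slice_eq smooth_slice
    (hasCompactSupport_slice hφs y)
  simpa only [(hasDerivAt_slice (hφ.differentiable (by simp)) y _).deriv] using by_parts

end Product

theorem IsWeakDerivAlong.mono {E : Type*} [NormedAddCommGroup E] [NormedSpace ℝ E]
    [MeasurableSpace E] {μ : Measure E} {Ω Ω' : Set E} {v : E} {u g : E → ℝ}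
    (h : IsWeakDerivAlong μ Ω' v u g) (hΩ : Ω ⊆ Ω') : IsWeakDerivAlong μ Ω v u g :=
  fun φ hφ hφs hφΩ => h φ hφ hφs (hφΩ.trans hΩ)

section Transfer

variable {E F : Type*} [NormedAddCommGroup E] [NormedSpace ℝ E] [MeasurableSpace E] [BorelSpace E]
  [NormedAddCommGroup F] [NormedSpace ℝ F] [MeasurableSpace F] [BorelSpace F] {μ : Measure E}
  {ν : Measure F} {Ω : Set F} {v : E} {u g : F → ℝ}

theorem IsWeakDerivAlong.comp_continuousLinearEquiv {L : E ≃L[ℝ] F}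
    (h : IsWeakDerivAlong ν Ω (L v) u g) (hL : MeasurePreserving L μ ν) :
    IsWeakDerivAlong μ (L ⁻¹' Ω) v (u ∘ L) (g ∘ L) := by
  intro φ hφ hφs hφΩ
  have test := h (φ ∘ L.symm) (hφ.comp L.symm.contDiff)
    (hφs.comp_homeomorph L.symm.toHomeomorph) fun x hx => by
      simpa using hφΩ (tsupport_comp_subset_preimage φ L.symm.continuous hx)
  have change_variables : ∀ f : F → ℝ, ∫ x, f x ∂ν = ∫ z, f (L z) ∂μ := fun f =>
    (hL.integral_comp L.toHomeomorph.measurableEmbedding f).symm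
  rw [change_variables, change_variables] at test
  simpa [L.symm.comp_right_fderiv] using test

theorem isWeakDerivAlong_comp_continuousLinearEquiv_iff {L : E ≃L[ℝ] F}
    (hL : MeasurePreserving L μ ν) :
    IsWeakDerivAlong μ (L ⁻¹' Ω) v (u ∘ L) (g ∘ L) ↔ IsWeakDerivAlong ν Ω (L v) u g := by
  refine ⟨fun h => ?_, fun h => h.comp_continuousLinearEquiv hL⟩
  have hL' : MeasurePreserving L.symm ν μ :=
    MeasurePreserving.symm (e := L.toHomeomorph.toMeasurableEquiv) hL
  rw [← L.symm_apply_apply v] at h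
  simpa only [← Set.preimage_comp, Function.comp_assoc, ContinuousLinearEquiv.self_comp_symm,
    Set.preimage_id, Function.comp_id] using h.comp_continuousLinearEquiv hL'

end Transfer

theorem isWeakDerivAlong_of_span_eq_top {E : Type*} [NormedAddCommGroup E] [NormedSpace ℝ E]
    [MeasurableSpace E] [OpensMeasurableSpace E] {μ : Measure E} {Ω : Set E} {u : E → ℝ}
    {G : E → E →L[ℝ] ℝ} (hu : LocallyIntegrable u μ) (hG : LocallyIntegrable G μ) {s : Set E}
    (hs : Submodule.span ℝ s = ⊤) (h : ∀ v ∈ s, IsWeakDerivAlong μ Ω v u fun x => G x v) (v : E) :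
    IsWeakDerivAlong μ Ω v u fun x => G x v := by
  intro φ hφ hφs hφΩ
  have integrable_u : Integrable (fun x => u x • fderiv ℝ φ x) μ :=
    hu.integrable_smul_right_of_hasCompactSupport (hφ.continuous_fderiv (by simp)) (hφs.fderiv ℝ)
  have integrable_G : Integrable (fun x => φ x • G x) μ :=
    hG.integrable_smul_left_of_hasCompactSupport hφ.continuous hφs
  have pairing_u : ∀ w, (∫ x, u x • fderiv ℝ φ x ∂μ) w = ∫ x, u x * fderiv ℝ φ x w ∂μ := fun w =>
    ContinuousLinearMap.integral_apply integrable_u w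
  have pairing_G : ∀ w, (∫ x, φ x • G x ∂μ) w = ∫ x, G x w * φ x ∂μ := fun w => by
    rw [ContinuousLinearMap.integral_apply integrable_G]
    simp only [smul_apply, smul_eq_mul, mul_comm]
  have functionals_eq : ∫ x, u x • fderiv ℝ φ x ∂μ = -∫ x, φ x • G x ∂μ := by
    refine ContinuousLinearMap.coe_injective (LinearMap.ext_on hs fun w hw => ?_)
    simpa only [ContinuousLinearMap.coe_coe, neg_apply, pairing_u, pairing_G]
      using h w hw φ hφ hφs hφΩ
  simpa only [neg_apply, pairing_u, pairing_G] using
    DFunLike.congr_fun functionals_eq v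

end WeakDerivative

theorem locallyIntegrable_clm_comp {E F F' : Type*} [TopologicalSpace E] [MeasurableSpace E]
    [NormedAddCommGroup F] [NormedSpace ℝ F] [NormedAddCommGroup F'] [NormedSpace ℝ F']
    {μ : Measure E} {f : E → F} (hf : LocallyIntegrable f μ) (T : F →L[ℝ] F') :
    LocallyIntegrable (fun x => T (f x)) μ := fun x =>
  let ⟨s, hs, h⟩ := hf x
  ⟨s, hs, T.integrable_comp h⟩

section Lines

variable {E : Type*} [NormedAddCommGroup E] [InnerProductSpace ℝ E] [FiniteDimensional ℝ E]
  {v : E}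

/-- The linear coordinates `(y, t) ↦ y + t • v` on `E` given by a direction `v ≠ 0`, where `y`
runs through the hyperplane orthogonal to `v`. -/
noncomputable def lineCoordinates (hv : v ≠ 0) : ((Submodule.span ℝ {v})ᗮ × ℝ) ≃L[ℝ] E :=
  (((LinearEquiv.refl ℝ _).prodCongr (LinearEquiv.toSpanNonzeroSingleton ℝ _ v hv)).trans
    (Submodule.prodEquivOfIsCompl _ _
      (Submodule.isCompl_orthogonal (K := Submodule.span ℝ {v})).symm)).toContinuousLinearEquiv

theorem lineCoordinates_apply (hv : v ≠ 0) (y : (Submodule.span ℝ {v})ᗮ) (t : ℝ) :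
    lineCoordinates hv (y, t) = y + t • v := by
  simp [lineCoordinates]

variable [MeasurableSpace E] [BorelSpace E]

theorem exists_measurePreserving_lineCoordinates (hv : v ≠ 0) :
    ∃ c : NNReal, c ≠ 0 ∧ MeasurePreserving (lineCoordinates hv)
      ((c • (volume : Measure (Submodule.span ℝ {v})ᗮ)).prod volume) volume := by
  let ν : Measure E := Measure.map (lineCoordinates hv)
    ((volume : Measure (Submodule.span ℝ {v})ᗮ).prod (volume : Measure ℝ))
  have : ν.IsAddHaarMeasure := (lineCoordinates hv).isAddHaarMeasure_map _
  refine ⟨Measure.addHaarScalarFactor volume ν,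
    (Measure.addHaarScalarFactor_pos_of_isAddHaarMeasure _ _).ne',
    (lineCoordinates hv).continuous.measurable, ?_⟩
  rw [Measure.prod_smul_left, Measure.map_smul]
  exact (Measure.isAddLeftInvariant_eq_smul (volume : Measure E) ν).symm

/-- `u` is continuous on almost every line parallel to `v`; the lines are parametrized by their
intersection with the hyperplane orthogonal to `v`. -/
def ContinuousOnAELines (u : E → ℝ) (v : E) : Prop :=
  ∀ᵐ y : (Submodule.span ℝ {v})ᗮ, Continuous fun t : ℝ => u (y + t • v)

theorem volume_eq_zero_of_countable_lines (hv : v ≠ 0) {K : Set E} (hK : MeasurableSet K)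
    (hKc : ∀ᵐ y : (Submodule.span ℝ {v})ᗮ, {t : ℝ | (y : E) + t • v ∈ K}.Countable) :
    volume K = 0 := by
  obtain ⟨c, -, hL⟩ := exists_measurePreserving_lineCoordinates hv
  rw [← hL.measure_preimage hK.nullMeasurableSet,
    Measure.measure_prod_null (hL.measurable hK)]
  filter_upwards [Measure.ae_smul_measure hKc c] with y hy
  simp only [← lineCoordinates_apply hv] at hy
  exact hy.measure_zero _

theorem IsWeakDerivAlong.univ_of_countable_lines {K : Set E} {u g : E → ℝ}
    (h : IsWeakDerivAlong volume Kᶜ v u g) (hv : v ≠ 0) (hK : IsClosed K)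
    (hu : LocallyIntegrable u) (hg : LocallyIntegrable g)
    (hKc : ∀ᵐ y : (Submodule.span ℝ {v})ᗮ, {t : ℝ | (y : E) + t • v ∈ K}.Countable)
    (huc : ContinuousOnAELines u v) :
    IsWeakDerivAlong volume Set.univ v u g := by
  obtain ⟨c, -, hL⟩ := exists_measurePreserving_lineCoordinates hv
  have locallyIntegrable_comp : ∀ {f : E → ℝ}, LocallyIntegrable f →
      LocallyIntegrable (f ∘ lineCoordinates hv)
        ((c • (volume : Measure (Submodule.span ℝ {v})ᗮ)).prod volume) := fun {f} hf => by
    rw [← hL.map_eq] at hf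
    exact (locallyIntegrable_map_homeomorph (lineCoordinates hv).toHomeomorph).1 hf
  have direction : lineCoordinates hv (0, 1) = v := by simp [lineCoordinates_apply]
  rw [← direction, ← isWeakDerivAlong_comp_continuousLinearEquiv_iff hL] at h ⊢
  simp only [ContinuousOnAELines, ← lineCoordinates_apply hv] at hKc huc
  exact h.univ_of_countable_slices (hK.preimage (lineCoordinates hv).continuous)
    (locallyIntegrable_comp hu) (locallyIntegrable_comp hg) (Measure.ae_smul_measure hKc c)
    (Measure.ae_smul_measure huc c)

theorem isWeakDerivAlong_univ_of_countable_lines {K : Set E} {u : E → ℝ} {G : E → E →L[ℝ] ℝ}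
    (hK : IsClosed K) (hu : LocallyIntegrable u) (hG : LocallyIntegrable G)
    (h : ∀ v, IsWeakDerivAlong volume Kᶜ v u fun x => G x v) {s : Set E}
    (hs : Submodule.span ℝ s = ⊤) (hs0 : ∀ v ∈ s, v ≠ 0)
    (hKc : ∀ v ∈ s, ∀ᵐ y : (Submodule.span ℝ {v})ᗮ, {t : ℝ | (y : E) + t • v ∈ K}.Countable)
    (huc : ∀ v ∈ s, ContinuousOnAELines u v) (v : E) :
    IsWeakDerivAlong volume Set.univ v u fun x => G x v :=
  isWeakDerivAlong_of_span_eq_top hu hG hs (fun v hv =>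
    (h v).univ_of_countable_lines (hs0 v hv) hK hu
      (locallyIntegrable_clm_comp hG (ContinuousLinearMap.apply ℝ ℝ v)) (hKc v hv) (huc v hv)) v

end Lines

section Capacity

theorem enorm_le_lintegral_add_deriv {F : Type*} [NormedAddCommGroup F] [NormedSpace ℝ F]
    [CompleteSpace F] {f : ℝ → F} (hf : ContDiff ℝ 1 f) (a : ℝ) :
    ‖f a‖ₑ ≤ ∫⁻ t in Set.Ioc a (a + 1), (‖f t‖ₑ + ‖deriv f t‖ₑ) := by
  have continuous_deriv : Continuous (deriv f) := hf.continuous_deriv le_rfl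
  have pointwise : ∀ s ∈ Set.Ioc a (a + 1),
      ‖f a‖ₑ ≤ ‖f s‖ₑ + ∫⁻ t in Set.Ioc a (a + 1), ‖deriv f t‖ₑ := fun s hs => by
    have ftc : f a = f s - ∫ t in Set.Ioc a s, deriv f t := by
      rw [← intervalIntegral.integral_of_le hs.1.le, intervalIntegral.integral_deriv_eq_sub
        (fun x _ => hf.differentiable (by simp) x) (continuous_deriv.intervalIntegrable _ _),
        sub_sub_cancel]
    calc ‖f a‖ₑ ≤ ‖f s‖ₑ + ‖∫ t in Set.Ioc a s, deriv f t‖ₑ := ftc ▸ enorm_sub_le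
      _ ≤ ‖f s‖ₑ + ∫⁻ t in Set.Ioc a s, ‖deriv f t‖ₑ := by
          gcongr; exact enorm_integral_le_lintegral_enorm _
      _ ≤ ‖f s‖ₑ + ∫⁻ t in Set.Ioc a (a + 1), ‖deriv f t‖ₑ := by
          gcongr; exact hs.2
  calc ‖f a‖ₑ = ∫⁻ _ in Set.Ioc a (a + 1), ‖f a‖ₑ := by simp
    _ ≤ ∫⁻ s in Set.Ioc a (a + 1), (‖f s‖ₑ + ∫⁻ t in Set.Ioc a (a + 1), ‖deriv f t‖ₑ) :=
        setLIntegral_mono' measurableSet_Ioc pointwise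
    _ = ∫⁻ t in Set.Ioc a (a + 1), (‖f t‖ₑ + ‖deriv f t‖ₑ) := by
        rw [lintegral_add_right _ measurable_const,
          lintegral_add_right _ continuous_deriv.enorm.measurable]
        simp

theorem exists_setLIntegral_enorm_le_eLpNorm {α F : Type*} [MeasurableSpace α]
    [NormedAddCommGroup F] {μ : Measure α} {p : ℝ≥0∞} (hp : 1 ≤ p) {s : Set α} (hs : μ s ≠ ∞) :
    ∃ C : ℝ≥0∞, C ≠ ∞ ∧ ∀ f : α → F, AEStronglyMeasurable f μ →
      ∫⁻ x in s, ‖f x‖ₑ ∂μ ≤ C * eLpNorm f p μ := by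
  refine ⟨μ s ^ (1 / (1 : ℝ≥0∞).toReal - 1 / p.toReal),
    ENNReal.rpow_ne_top_of_nonneg ?_ hs, fun f hf => ?_⟩
  · rcases eq_or_ne p ∞ with rfl | hp_top
    · simp
    · have : 1 ≤ p.toReal := by simpa using ENNReal.toReal_mono hp_top hp
      simpa using inv_le_one_of_one_le₀ this
  · calc ∫⁻ x in s, ‖f x‖ₑ ∂μ = eLpNorm f 1 (μ.restrict s) := eLpNorm_one_eq_lintegral_enorm.symm
      _ ≤ eLpNorm f p (μ.restrict s) * μ s ^ (1 / (1 : ℝ≥0∞).toReal - 1 / p.toReal) := by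
          simpa only [Measure.restrict_apply_univ] using
            eLpNorm_le_eLpNorm_mul_rpow_measure_univ hp hf.restrict
      _ ≤ μ s ^ (1 / (1 : ℝ≥0∞).toReal - 1 / p.toReal) * eLpNorm f p μ := by
          rw [mul_comm]
          gcongr
          exact Measure.restrict_le_self

theorem measure_image_fst_le_lintegral {Y : Type*} [NormedAddCommGroup Y] [NormedSpace ℝ Y]
    [MeasurableSpace Y] [BorelSpace Y] {μ : Measure Y} [SFinite μ]
    {f : Y × ℝ → ℝ} (hf : ContDiff ℝ 1 f) (R : ℝ) :
    μ (Prod.fst '' (ball 0 R ∩ {z | 1 ≤ f z})) ≤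
      ∫⁻ z in ball 0 (R + 1), (‖f z‖ₑ + ‖fderiv ℝ f z (0, 1)‖ₑ) ∂μ.prod volume := by
  have smooth_slice : ∀ y, ContDiff ℝ 1 fun s => f (y, s) := fun y =>
    hf.comp (contDiff_prodMk_right y)
  have measurable_integrand : Measurable fun z => ‖f z‖ₑ + ‖fderiv ℝ f z (0, 1)‖ₑ :=
    hf.continuous.measurable.enorm.add
      ((hf.continuous_fderiv one_ne_zero).clm_apply continuous_const).measurable.enorm
  have measurable_slice_integral : Measurable fun y =>
      ∫⁻ t in ball 0 (R + 1), (‖f (y, t)‖ₑ + ‖fderiv ℝ f (y, t) (0, 1)‖ₑ) :=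
    measurable_integrand.lintegral_prod_right'
  have image_subset : Prod.fst '' (ball 0 R ∩ {z | 1 ≤ f z}) ⊆
      {y | 1 ≤ ∫⁻ t in ball 0 (R + 1), (‖f (y, t)‖ₑ + ‖fderiv ℝ f (y, t) (0, 1)‖ₑ)} ∩
        ball 0 (R + 1) := by
    rintro _ ⟨⟨y, t⟩, ⟨hz, hf1⟩, rfl⟩
    obtain ⟨hy, ht⟩ : ‖y‖ < R ∧ |t| < R := by simpa using hz
    refine ⟨?_, mem_ball_zero_iff.2 (hy.trans (lt_add_one R))⟩
    calc (1 : ℝ≥0∞) ≤ ‖f (y, t)‖ₑ := by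
          rw [Real.enorm_eq_ofReal_abs, ENNReal.one_le_ofReal]
          exact hf1.trans (le_abs_self _)
      _ ≤ ∫⁻ s in Set.Ioc t (t + 1), (‖f (y, s)‖ₑ + ‖fderiv ℝ f (y, s) (0, 1)‖ₑ) := by
          simpa only [(hasDerivAt_slice (hf.differentiable (by simp)) y _).deriv] using
            enorm_le_lintegral_add_deriv (smooth_slice y) t
      _ ≤ ∫⁻ s in ball 0 (R + 1), (‖f (y, s)‖ₑ + ‖fderiv ℝ f (y, s) (0, 1)‖ₑ) := by
          refine lintegral_mono_set fun s hs => ?_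
          rw [mem_ball_zero_iff, Real.norm_eq_abs, abs_lt]
          constructor <;> linarith [(abs_lt.1 ht).1, (abs_lt.1 ht).2, hs.1, hs.2]
  have ball_eq : ball (0 : Y × ℝ) (R + 1) = ball 0 (R + 1) ×ˢ ball 0 (R + 1) :=
    (ball_prod_same _ _ _).symm
  rw [ball_eq, ← Measure.prod_restrict,
    lintegral_prod _ measurable_integrand.aemeasurable]
  calc μ (Prod.fst '' (ball 0 R ∩ {z | 1 ≤ f z}))
      ≤ μ.restrict (ball 0 (R + 1))
          {y | 1 ≤ ∫⁻ t in ball 0 (R + 1), (‖f (y, t)‖ₑ + ‖fderiv ℝ f (y, t) (0, 1)‖ₑ)} := by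
        rw [Measure.restrict_apply (measurableSet_le measurable_const measurable_slice_integral)]
        exact measure_mono image_subset
    _ ≤ _ := by simpa using mul_meas_ge_le_lintegral measurable_slice_integral 1

variable {N : ℕ}

theorem eLpNorm_fderiv_apply_le {p : ℝ≥0∞} (hp : 1 ≤ p) {φ : EuclideanSpace ℝ (Fin N) → ℝ}
    (hφ : ContDiff ℝ 1 φ) (v : EuclideanSpace ℝ (Fin N)) :
    eLpNorm (fun x => fderiv ℝ φ x v) p volume ≤
      (∑ i, ‖v i‖ₑ) * ∑ i, eLpNorm (partialDeriv i φ) p volume := by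
  have eq_sum : (fun x => fderiv ℝ φ x v) = ∑ i, v i • partialDeriv i φ := by
    ext x
    conv_lhs => rw [← (EuclideanSpace.basisFun (Fin N) ℝ).sum_repr v]
    simp [partialDeriv]
  have measurable_partialDeriv : ∀ i, AEStronglyMeasurable (partialDeriv i φ) volume := fun i =>
    ((hφ.continuous_fderiv one_ne_zero).clm_apply continuous_const).aestronglyMeasurable
  rw [eq_sum, Finset.sum_mul]
  refine (eLpNorm_sum_le (fun i _ => (measurable_partialDeriv i).const_smul _) hp).trans
    (Finset.sum_le_sum fun i hi => ?_)
  rw [eLpNorm_const_smul]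
  gcongr
  exact Finset.single_le_sum (f := fun i => eLpNorm (partialDeriv i φ) p volume)
    (fun _ _ => zero_le) hi

variable {Y : Type*} [NormedAddCommGroup Y] [NormedSpace ℝ Y]

/-- The projection to `Y`, along the last coordinate, of the part of `F` that lies in the ball of
radius `R`, in linear coordinates `L : Y × ℝ ≃ ℝ^N`. -/
def boundedShadow (L : (Y × ℝ) ≃L[ℝ] EuclideanSpace ℝ (Fin N)) (R : ℝ)
    (F : Set (EuclideanSpace ℝ (Fin N))) : Set Y :=
  Prod.fst '' (ball 0 R ∩ L ⁻¹' F)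

theorem boundedShadow_mono (L : (Y × ℝ) ≃L[ℝ] EuclideanSpace ℝ (Fin N)) (R : ℝ) :
    Monotone (boundedShadow L R) := fun _ _ h =>
  Set.image_mono (Set.inter_subset_inter_right _ (Set.preimage_mono h))

theorem boundedShadow_iUnion (L : (Y × ℝ) ≃L[ℝ] EuclideanSpace ℝ (Fin N)) (R : ℝ) {ι : Sort*}
    (F : ι → Set (EuclideanSpace ℝ (Fin N))) :
    boundedShadow L R (⋃ i, F i) = ⋃ i, boundedShadow L R (F i) := by
  simp only [boundedShadow, Set.preimage_iUnion, Set.inter_iUnion, Set.image_iUnion]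

variable [FiniteDimensional ℝ Y] [MeasurableSpace Y] [BorelSpace Y] {μ : Measure Y}
  [IsLocallyFiniteMeasure μ] {p : ℝ≥0∞} {L : (Y × ℝ) ≃L[ℝ] EuclideanSpace ℝ (Fin N)}

theorem exists_measure_boundedShadow_le_sobolevNorm (hp : 1 ≤ p)
    (hL : MeasurePreserving L (μ.prod volume) volume) (R : ℝ) :
    ∃ C : ℝ≥0∞, C ≠ ∞ ∧ ∀ φ : EuclideanSpace ℝ (Fin N) → ℝ, ContDiff ℝ 1 φ →
      μ (boundedShadow L R {x | 1 ≤ φ x}) ≤ C * sobolevNorm p φ := by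
  have : ProperSpace Y := FiniteDimensional.proper_real Y
  obtain ⟨M, hM, hölder⟩ := exists_setLIntegral_enorm_le_eLpNorm (F := ℝ) hp
    (measure_ball_lt_top (μ := μ.prod (volume : Measure ℝ)) (x := 0) (r := R + 1)).ne
  set S : ℝ≥0∞ := ∑ i, ‖L (0, 1) i‖ₑ
  have hS_top : S ≠ ∞ := ENNReal.sum_ne_top.2 fun i _ => enorm_ne_top
  refine ⟨M * (1 + S), by finiteness, fun φ hφ => ?_⟩
  have continuous_fderiv : Continuous fun x => fderiv ℝ φ x (L (0, 1)) :=
    (hφ.continuous_fderiv one_ne_zero).clm_apply continuous_const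
  have setLIntegral_le : ∀ f : EuclideanSpace ℝ (Fin N) → ℝ, Continuous f →
      ∫⁻ z in ball 0 (R + 1), ‖f (L z)‖ₑ ∂μ.prod volume ≤ M * eLpNorm f p volume := fun f hf => by
    rw [← eLpNorm_comp_measurePreserving hf.aestronglyMeasurable hL]
    exact hölder _ (hf.comp L.continuous).aestronglyMeasurable
  calc μ (boundedShadow L R {x | 1 ≤ φ x})
      ≤ ∫⁻ z in ball 0 (R + 1), (‖φ (L z)‖ₑ + ‖fderiv ℝ (φ ∘ L) z (0, 1)‖ₑ) ∂μ.prod volume :=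
        measure_image_fst_le_lintegral (hφ.comp L.contDiff) R
    _ = ∫⁻ z in ball 0 (R + 1), ‖φ (L z)‖ₑ ∂μ.prod volume +
          ∫⁻ z in ball 0 (R + 1), ‖fderiv ℝ φ (L z) (L (0, 1))‖ₑ ∂μ.prod volume := by
        simp only [L.comp_right_fderiv, ContinuousLinearMap.comp_apply,
          ContinuousLinearEquiv.coe_coe]
        exact lintegral_add_left (hφ.continuous.comp L.continuous).enorm.measurable _
    _ ≤ M * eLpNorm φ p volume + M * eLpNorm (fun x => fderiv ℝ φ x (L (0, 1))) p volume :=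
        add_le_add (setLIntegral_le _ hφ.continuous) (setLIntegral_le _ continuous_fderiv)
    _ ≤ M * sobolevNorm p φ + M * (S * sobolevNorm p φ) := by
        gcongr
        · exact le_self_add
        · refine (eLpNorm_fderiv_apply_le hp hφ _).trans ?_
          gcongr
          exact le_add_self
    _ = M * (1 + S) * sobolevNorm p φ := by ring

theorem exists_measure_boundedShadow_le_capCompact (hp : 1 ≤ p)
    (hL : MeasurePreserving L (μ.prod volume) volume) (R : ℝ) :
    ∃ C : ℝ≥0∞, C ≠ ∞ ∧ ∀ F : Set (EuclideanSpace ℝ (Fin N)),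
      μ (boundedShadow L R F) ≤ C * capCompact p F := by
  obtain ⟨C, hC, h⟩ := exists_measure_boundedShadow_le_sobolevNorm hp hL R
  have hC1 : C + 1 ≠ 0 := by simp
  have hC1_top : C + 1 ≠ ∞ := by finiteness
  refine ⟨C + 1, hC1_top, fun F => ?_⟩
  rw [mul_comm, ← ENNReal.div_le_iff hC1 hC1_top]
  refine le_sInf ?_
  rintro _ ⟨φ, ⟨hφ, -⟩, hF, rfl⟩
  refine ENNReal.div_le_of_le_mul' ?_
  calc μ (boundedShadow L R F) ≤ μ (boundedShadow L R {x | 1 ≤ φ x}) :=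
        measure_mono (boundedShadow_mono L R hF)
    _ ≤ C * sobolevNorm p φ := h φ (hφ.of_le (by simp))
    _ ≤ (C + 1) * sobolevNorm p φ := by gcongr; exact le_self_add

theorem exists_measure_boundedShadow_le_capOpen (hp : 1 ≤ p)
    (hL : MeasurePreserving L (μ.prod volume) volume) (R : ℝ) :
    ∃ C : ℝ≥0∞, C ≠ ∞ ∧ ∀ ω : Set (EuclideanSpace ℝ (Fin N)), IsOpen ω →
      μ (boundedShadow L R ω) ≤ C * capOpen p ω := by
  obtain ⟨C, hC, h⟩ := exists_measure_boundedShadow_le_capCompact hp hL R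
  refine ⟨C, hC, fun ω hω => ?_⟩
  have : LocallyCompactSpace ω := hω.locallyCompactSpace
  obtain ⟨F, hF, rfl⟩ : IsSigmaCompact ω := isSigmaCompact_iff_sigmaCompactSpace.2 inferInstance
  rw [← Set.iUnion_accumulate, boundedShadow_iUnion,
    Monotone.measure_iUnion fun _ _ h => boundedShadow_mono L R (Set.monotone_accumulate h)]
  refine iSup_le fun n => (h _).trans ?_
  gcongr
  exact le_sSup ⟨_, isCompact_accumulate hF n, Set.subset_iUnion _ n, rfl⟩

theorem ae_exists_notMem_boundedShadow (hp : 1 ≤ p)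
    (hL : MeasurePreserving L (μ.prod volume) volume) {ω : ℕ → Set (EuclideanSpace ℝ (Fin N))}
    (hω : ∀ n, IsOpen (ω n)) (hcap : Tendsto (fun n => capOpen p (ω n)) atTop (𝓝 0)) (R : ℝ) :
    ∀ᵐ y ∂μ, ∃ n, y ∉ boundedShadow L R (ω n) := by
  obtain ⟨C, hC, h⟩ := exists_measure_boundedShadow_le_capOpen hp hL R
  have tendsto_bound : Tendsto (fun n => C * capOpen p (ω n)) atTop (𝓝 0) := by
    simpa using ENNReal.Tendsto.const_mul hcap (Or.inr hC)
  have measure_iInter : μ (⋂ n, boundedShadow L R (ω n)) = 0 :=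
    le_antisymm (ge_of_tendsto' tendsto_bound fun n =>
      (measure_mono (Set.iInter_subset _ n)).trans (h _ (hω n))) zero_le
  filter_upwards [measure_eq_zero_iff_ae_notMem.1 measure_iInter] with y hy
  simpa using hy

theorem ae_continuous_slice_of_mem_quasiContinuous (hp : 1 ≤ p)
    (hL : MeasurePreserving L (μ.prod volume) volume) {u : EuclideanSpace ℝ (Fin N) → ℝ}
    (hu : u ∈ quasiContinuous p) : ∀ᵐ y ∂μ, Continuous fun t => u (L (y, t)) := by
  choose ω hω hcap hcont using fun n : ℕ =>
    hu.2 (n : ℝ≥0∞)⁻¹ (ENNReal.inv_pos.2 (ENNReal.natCast_ne_top n))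
  have tendsto_cap : Tendsto (fun n => capOpen p (ω n)) atTop (𝓝 0) :=
    tendsto_of_tendsto_of_tendsto_of_le_of_le tendsto_const_nhds
      ENNReal.tendsto_inv_nat_nhds_zero (fun _ => zero_le) fun n => (hcap n).le
  filter_upwards [ae_all_iff.2 fun R : ℕ => ae_exists_notMem_boundedShadow hp hL hω tendsto_cap R]
    with y hy
  refine continuous_iff_continuousAt.2 fun t => ?_
  obtain ⟨R, hR⟩ := exists_nat_gt ‖(y, t)‖
  obtain ⟨n, hn⟩ := hy R
  have maps_to : Set.MapsTo (fun s => L (y, s)) {s | (y, s) ∈ ball 0 (R : ℝ)} (ω n)ᶜ :=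
    fun s hs hsω => hn ⟨(y, s), ⟨hs, hsω⟩, rfl⟩
  exact ((hcont n).comp (by fun_prop) maps_to).continuousAt
    ((isOpen_ball.preimage (Continuous.prodMk_right y)).mem_nhds (mem_ball_zero_iff.2 hR))

theorem continuousOnAELines_of_mem_quasiContinuous (hp : 1 ≤ p)
    {u : EuclideanSpace ℝ (Fin N) → ℝ} (hu : u ∈ quasiContinuous p)
    {v : EuclideanSpace ℝ (Fin N)} (hv : v ≠ 0) : ContinuousOnAELines u v := by
  obtain ⟨c, hc, hL⟩ := exists_measurePreserving_lineCoordinates hv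
  have := ae_continuous_slice_of_mem_quasiContinuous hp hL hu
  rw [Measure.ae_smul_measure_iff hc] at this
  simpa only [ContinuousOnAELines, lineCoordinates_apply] using this

end Capacity

section Sobolev

variable {N : ℕ}

theorem isWeakPartialDeriv_iff {Ω : Set (EuclideanSpace ℝ (Fin N))} {i : Fin N}
    {u g : EuclideanSpace ℝ (Fin N) → ℝ} :
    IsWeakPartialDeriv Ω i u g ↔
      IsWeakDerivAlong volume Ω (EuclideanSpace.single i 1) u g := by
  refine ⟨fun h φ hφ hφs hφΩ => ?_, fun h φ ⟨hφ, hφs, hφΩ⟩ => ?_⟩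
  all_goals
    have zero_mul_test : ∀ x ∉ Ω, g x * φ x = 0 := fun x hx => by
      rw [image_eq_zero_of_notMem_tsupport fun h => hx (hφΩ h), mul_zero]
    have zero_fderiv : ∀ x ∉ Ω, u x * partialDeriv i φ x = 0 := fun x hx => by
      rw [partialDeriv, image_eq_zero_of_notMem_tsupport fun h =>
        hx (hφΩ (tsupport_fderiv_subset ℝ h)), zero_apply, mul_zero]
  · have := h φ ⟨hφ, hφs, hφΩ⟩
    rwa [setIntegral_eq_integral_of_forall_compl_eq_zero zero_mul_test,
      setIntegral_eq_integral_of_forall_compl_eq_zero zero_fderiv] at this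
  · rw [setIntegral_eq_integral_of_forall_compl_eq_zero zero_mul_test,
      setIntegral_eq_integral_of_forall_compl_eq_zero zero_fderiv]
    exact h φ hφ hφs hφΩ

theorem AELineMeetsCountably.ae_countable {K : Set (EuclideanSpace ℝ (Fin N))}
    {v : EuclideanSpace ℝ (Fin N)} (h : AELineMeetsCountably K v) (hv : v ≠ 0) :
    ∀ᵐ y : (Submodule.span ℝ {v})ᗮ,
      {t : ℝ | (y : EuclideanSpace ℝ (Fin N)) + t • v ∈ K}.Countable := by
  filter_upwards [h] with y hy
  have injective : Function.Injective fun t : ℝ => (y : EuclideanSpace ℝ (Fin N)) + t • v :=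
    (add_right_injective _).comp (smul_left_injective ℝ hv)
  refine (hy.preimage injective).mono fun t ht => ?_
  exact ⟨ht, t, rfl⟩

theorem mem_W1p_iff {p : ℝ≥0∞} {Ω : Set (EuclideanSpace ℝ (Fin N))}
    {u : EuclideanSpace ℝ (Fin N) → ℝ} :
    u ∈ W1p p Ω ↔ MemLp u p (volume.restrict Ω) ∧ ∀ i : Fin N, ∃ g,
      MemLp g p (volume.restrict Ω) ∧
        IsWeakDerivAlong volume Ω (EuclideanSpace.single i 1) u g := by
  simp only [W1p, isWeakPartialDeriv_iff, Set.mem_ofPred_eq]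

theorem isWeakDerivAlong_single_univ_of_countable_lines {K : Set (EuclideanSpace ℝ (Fin N))}
    (hK : IsClosed K) {v : Fin N → EuclideanSpace ℝ (Fin N)} (hv : LinearIndependent ℝ v)
    (hlines : ∀ i, AELineMeetsCountably K (v i)) {u : EuclideanSpace ℝ (Fin N) → ℝ}
    {g : Fin N → EuclideanSpace ℝ (Fin N) → ℝ} (hu : LocallyIntegrable u)
    (hg : ∀ i, LocallyIntegrable (g i)) (huc : ∀ i, ContinuousOnAELines u (v i))
    (h : ∀ i, IsWeakDerivAlong volume Kᶜ (EuclideanSpace.single i 1) u (g i)) (i : Fin N) :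
    IsWeakDerivAlong volume Set.univ (EuclideanSpace.single i 1) u (g i) := by
  let G : EuclideanSpace ℝ (Fin N) → EuclideanSpace ℝ (Fin N) →L[ℝ] ℝ :=
    fun x => ∑ i, g i x • EuclideanSpace.proj i
  have G_single : ∀ i x, G x (EuclideanSpace.single i 1) = g i x := fun i x => by simp [G]
  have locallyIntegrable_G : LocallyIntegrable G :=
    locallyIntegrable_finsetSum (ε''' := EuclideanSpace ℝ (Fin N) →L[ℝ] ℝ) _ fun i _ =>
      locallyIntegrable_clm_comp (hg i)
        (ContinuousLinearMap.toSpanSingleton ℝ (EuclideanSpace.proj i))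
  have weakDeriv_compl : ∀ w, IsWeakDerivAlong volume Kᶜ w u fun x => G x w := by
    refine isWeakDerivAlong_of_span_eq_top hu locallyIntegrable_G
      (EuclideanSpace.basisFun (Fin N) ℝ).toBasis.span_eq (Set.forall_mem_range.2 fun i => ?_)
    simpa only [OrthonormalBasis.coe_toBasis, EuclideanSpace.basisFun_apply, G_single] using h i
  have v_ne_zero : ∀ j, v j ≠ 0 := fun j => hv.ne_zero j
  have weakDeriv_univ := isWeakDerivAlong_univ_of_countable_lines hK hu locallyIntegrable_G
    weakDeriv_compl (hv.span_eq_top_of_card_eq_finrank' (by simp))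
    (Set.forall_mem_range.2 v_ne_zero)
    (Set.forall_mem_range.2 fun j => (hlines j).ae_countable (v_ne_zero j))
    (Set.forall_mem_range.2 huc) (EuclideanSpace.single i 1)
  simpa only [G_single] using weakDeriv_univ

theorem mem_W1p_compl_iff {p : ℝ≥0∞} (hp : 1 ≤ p) (hN : 1 ≤ N)
    {K : Set (EuclideanSpace ℝ (Fin N))} (hK : IsClosed K)
    {v : Fin N → EuclideanSpace ℝ (Fin N)} (hv : LinearIndependent ℝ v)
    (hlines : ∀ i, AELineMeetsCountably K (v i)) {u : EuclideanSpace ℝ (Fin N) → ℝ}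
    (huc : ∀ i, ContinuousOnAELines u (v i)) : u ∈ W1p p Kᶜ ↔ u ∈ W1p p Set.univ := by
  have v_ne_zero : v ⟨0, hN⟩ ≠ 0 := hv.ne_zero _
  have volume_K : volume K = 0 := volume_eq_zero_of_countable_lines v_ne_zero hK.measurableSet
    ((hlines _).ae_countable v_ne_zero)
  have restrict_compl : volume.restrict Kᶜ = (volume : Measure (EuclideanSpace ℝ (Fin N))) :=
    Measure.restrict_eq_self_of_ae_mem (measure_eq_zero_iff_ae_notMem.1 volume_K)
  simp only [mem_W1p_iff, restrict_compl, Measure.restrict_univ]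
  refine and_congr_right fun hu => ⟨fun h => ?_, fun h i => ?_⟩
  · choose g hg hgu using h
    exact fun i => ⟨g i, hg i, isWeakDerivAlong_single_univ_of_countable_lines hK hv hlines
      (hu.locallyIntegrable hp) (fun i => (hg i).locallyIntegrable hp) huc hgu i⟩
  · obtain ⟨g, hg, hgu⟩ := h i
    exact ⟨g, hg, hgu.mono (Set.subset_univ _)⟩

end Sobolev

end SobolevRemovability

open SobolevRemovability in
theorem corollary1p9_general (N : ℕ) (hN : 1 ≤ N) (p : ℝ≥0∞) (hp : 1 ≤ p)
    (K : Set (EuclideanSpace ℝ (Fin N))) (hK : IsClosed K)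
    (v : Fin N → EuclideanSpace ℝ (Fin N)) (hv : LinearIndependent ℝ v)
    (hlines : ∀ i : Fin N, AELineMeetsCountably K (v i)) :
    JProperty p K ∧ JPropertyCont p K := by
  have removable : ∀ {A : Set (EuclideanSpace ℝ (Fin N) → ℝ)},
      (∀ u ∈ A, ∀ i, ContinuousOnAELines u (v i)) → A ∩ W1p p Kᶜ = A ∩ W1p p Set.univ := fun hA =>
    Set.ext fun u => and_congr_right fun hu => mem_W1p_compl_iff hp hN hK hv hlines (hA u hu)
  exact ⟨removable fun u hu i => continuousOnAELines_of_mem_quasiContinuous hp hu (hv.ne_zero i),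
    removable fun u hu i => ae_of_all _ fun y => Continuous.comp hu (by fun_prop)⟩

theorem corollary1p9 (N : ℕ) (hN : 1 ≤ N) (p : ℝ≥0∞) (hp : 1 ≤ p) (hp_top : p ≠ ∞)
    (K : Set (EuclideanSpace ℝ (Fin N))) (hK : IsCompact K)
    (v : Fin N → EuclideanSpace ℝ (Fin N)) (hv : LinearIndependent ℝ v)
    (hlines : ∀ i : Fin N, SobolevRemovability.AELineMeetsCountably K (v i)) :
    SobolevRemovability.JProperty p K ∧ SobolevRemovability.JPropertyCont p K :=
  corollary1p9_general N hN p hp K hK.isClosed v hv hlines
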